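/- Let $d\ge 2$ and let $S\subset\mathbb{R}^d$ be a closed Lipschitz surface, i.e. a compact set that near each of its points is, after a rotation, the graph of a Lipschitz function of $d-1$ variables. Let $\sigma$ be the surface measure ($(d-1)$-dimensional Hausdorff measure) on $S$. Assume that $S$ satisfies the non-resonance condition with respect to $\mathbb{Z}^d$: $$\sigma(\{x\in S:\ \text{the unit normal } n(x) \text{ to } S \text{ at } x \text{ is well-defined and } n(x)\in\mathbb{R}\mathbb{Z}^d\})=0,$$ where $\mathbb{R}\mathbb{Z}^d=\{tk: t\in\mathbb{R},\,k\in\mathbb{Z}^d\}$. Let $\mathbb{T}^d=\mathbb{R}^d/\mathbb{Z}^d$, let $C(\mathbb{T}^d)$ be the space of real continuous functions on $\mathbb{T}^d$ (1-periodic continuous functions on $\mathbb{R}^d$) with the supremum norm, and let $$L^1(S;C(\mathbb{T}^d))=\Big\{f(x,y):\ \int_S\|f(x,\cdot)\|_{C(\mathbb{T}^d)}\,d\sigma(x)<\infty\Big\}$$ be the Bochner space of (classes of) strongly measurable integrable functions on $S$ with values in $C(\mathbb{T}^d)$. Let $X$ be a Banach space, with norm $\|\cdot\|_X$, compactly embedded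 into $L^1(S;C(\mathbb{T}^d))$. Then there exists a function $\omega$, depending only on $d$, $S$ and (the embedded space) $X$, such that $\omega(\lambda)$ is nonincreasing in $\lambda$ and tends to $0$ as $\lambda\to\infty$, and $$\Big|\int_S f(x,\lambda x)\,d\sigma(x)-\int_S\int_{\mathbb{T}^d}f(x,y)\,dy\,d\sigma(x)\Big|\le\omega(\lambda)\,\|f\|_X$$ for all $\lambda>0$ and all $f\in X$. -/

import Mathlib

open MeasureTheory Topology Filter Asymptotics
open scoped MeasureTheory ENNReal NNReal

/-- A closed Lipschitz surface in `ℝᵈ`: a compact set (without boundary) which near each of its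
points `p` is, after a rotation, the graph of a Lipschitz function. Here `e` is the unit vector in
the vertical direction of the rotated coordinates, and `φ` is a Lipschitz function on the
hyperplane perpendicular to `e`. -/
def IsClosedLipschitzSurface {d : ℕ} (S : Set (EuclideanSpace ℝ (Fin d))) : Prop :=
  IsCompact S ∧ ∀ p ∈ S, ∃ (e : EuclideanSpace ℝ (Fin d)) (r : ℝ) (K : ℝ≥0)
    (φ : (ℝ ∙ e)ᗮ → ℝ), ‖e‖ = 1 ∧ 0 < r ∧ LipschitzWith K φ ∧
      ∀ x ∈ Metric.ball p r, x ∈ S ↔ inner ℝ e x = φ ((ℝ ∙ e)ᗮ.orthogonalProjectionOnto x)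

/-- `n` is a unit normal of `S` at `x`, that is, the hyperplane through `x` perpendicular to the
unit vector `n` is tangent to `S` at `x`: `n · (y - x) = o(|y - x|)` as `y → x` within `S`.
If `S` is near `x` the graph of a Lipschitz function `φ`, such an `n` exists if and only if `φ` is
differentiable at the point below `x`, and it is then the classical normal
`± (∇φ, -1) / √(1 + |∇φ|²)`. -/
def IsUnitNormalAt {d : ℕ} (S : Set (EuclideanSpace ℝ (Fin d)))
    (x n : EuclideanSpace ℝ (Fin d)) : Prop :=
  ‖n‖ = 1 ∧ (fun y => inner ℝ n (y - x)) =o[𝓝[S] x] (fun y => y - x)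

/-- The vector `a` is rational, i.e. `a ∈ ℝ ℤᵈ`: a real multiple of an integer vector. -/
def IsRationalVector {d : ℕ} (a : EuclideanSpace ℝ (Fin d)) : Prop :=
  ∃ (t : ℝ) (k : Fin d → ℤ), ∀ i, a i = t * (k i : ℝ)

/-- The surface measure of `S`: the `(d-1)`-dimensional Hausdorff measure (normalized so as to
agree with Lebesgue measure on `ℝ^(d-1)`), restricted to `S`. -/
noncomputable def surfaceMeasure {d : ℕ} (S : Set (EuclideanSpace ℝ (Fin d))) :
    Measure (EuclideanSpace ℝ (Fin d)) :=
  (μHE[d - 1] : Measure (EuclideanSpace ℝ (Fin d))).restrict S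

/-- The non-resonance condition with respect to `ℤᵈ`: the points of `S` at which the unit normal is
well-defined and rational form a set of surface measure zero. -/
def NonResonant {d : ℕ} (S : Set (EuclideanSpace ℝ (Fin d))) : Prop :=
  surfaceMeasure S {x | x ∈ S ∧ ∃ n, IsUnitNormalAt S x n ∧ IsRationalVector n} = 0

/-- The projection of `ℝᵈ` onto the torus `𝕋ᵈ = ℝᵈ / ℤᵈ`. -/
def toTorus {d : ℕ} (x : EuclideanSpace ℝ (Fin d)) : UnitAddTorus (Fin d) :=
  fun i => ((x i : ℝ) : UnitAddCircle)

/-- The space `L¹(S; C(𝕋ᵈ))` (with respect to surface measure) of functions on `S` with values in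
the Banach space `C(𝕋ᵈ)` of real continuous functions on the torus with the supremum norm. An
element `f` stands for the function `(x, y) ↦ f x y`. -/
abbrev L1SurfaceTorus {d : ℕ} (S : Set (EuclideanSpace ℝ (Fin d))) : Type :=
  Lp C(UnitAddTorus (Fin d), ℝ) 1 (surfaceMeasure S)

/-!
The averaging error is a bounded linear functional of `F ∈ L¹(S; C(𝕋ᵈ))`, with norm at most `2`
for every dilation `l`. Hence it suffices to show that it tends to `0` for each fixed `F`
(`tendsto_averagingError`): the convergence is then uniform on the totally bounded image of the unit
ball of `X`, and the supremum of the errors over that ball and over all dilations `≥ l` is the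
required `ω l`.

For fixed `F`, density of the sums of functions `1_A(x) c(y)` and of the trigonometric polynomials
reduces the matter to `∫_A exp(2πi l ⟪k, x⟫) dσ(x) → 0` for integer vectors `k ≠ 0`. By the
Riemann–Lebesgue lemma this holds once the image of `σ` under the height function `⟪k, ·⟫` is
absolutely continuous (`surfaceMeasure_map_inner_absolutelyContinuous`).

This is where nonresonance enters. Parametrize a piece of `S` by a Lipschitz graph and let `g` be the
height function in these coordinates. If `N` is a Lebesgue null set then `g` has vanishing derivative
at almost every point of `g⁻¹ N` (`LipschitzWith.ae_hasFDerivAt_zero_of_mem_null`), and at such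
a point `k / ‖k‖` is a unit normal of `S`, because `g` controls the increments of `⟪k, ·⟫` on `S` to
first order. The normal is rational there, so these points form a set of surface measure zero, and
the exceptional parameters are mapped to a null set by the Lipschitz parametrization.
-/

/-! ### Critical points on preimages of null sets -/

/-- A set on which `ψ` expands small distances by at least the factor `1 / c` and which `ψ` maps
into a null set is a null set: locally `ψ` has a `c`-Lipschitz inverse there. -/
lemma volume_eq_zero_of_locally_expanding {ψ : ℝ → ℝ} {N A : Set ℝ} (hN : volume N = 0)
    (c : ℝ≥0) {δ : ℝ} (hδ : 0 < δ) (hA : ∀ t ∈ A, ψ t ∈ N)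
    (hexp : ∀ t ∈ A, ∀ s, |s - t| < δ → |s - t| ≤ c * |ψ s - ψ t|) : volume A = 0 := by
  refine measure_null_of_locally_null A fun t _ => ?_
  set u := A ∩ Metric.ball t (δ / 2) with hu
  refine ⟨u, inter_mem_nhdsWithin _ (Metric.ball_mem_nhds _ (half_pos hδ)), ?_⟩
  have hclose : ∀ x ∈ u, ∀ y ∈ u, |x - y| ≤ c * |ψ x - ψ y| := by
    intro x hx y hy
    refine hexp y hy.1 x ?_
    have h1 := hx.2
    have h2 := hy.2
    rw [Metric.mem_ball, Real.dist_eq, abs_lt] at h1 h2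
    rw [abs_lt]
    constructor <;> linarith [h1.1, h1.2, h2.1, h2.2]
  have hinj : Set.InjOn ψ u := by
    intro x hx y hy hxy
    have := hclose x hx y hy
    rw [hxy, sub_self, abs_zero, mul_zero] at this
    exact sub_eq_zero.1 (abs_nonpos_iff.1 this)
  have hlip : LipschitzOnWith c (Function.invFunOn ψ u) (ψ '' u) := by
    refine LipschitzOnWith.of_dist_le_mul ?_
    rintro _ ⟨x, hx, rfl⟩ _ ⟨y, hy, rfl⟩
    rw [hinj.leftInvOn_invFunOn hx, hinj.leftInvOn_invFunOn hy]
    exact hclose x hx y hy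
  have himg : Function.invFunOn ψ u '' (ψ '' u) = u := hinj.invFunOn_image subset_rfl
  have hle := hlip.hausdorffMeasure_image_le zero_le_one
  have h0 : volume (ψ '' u) = 0 :=
    measure_mono_null (by rintro _ ⟨x, hx, rfl⟩; exact hA x hx.1) hN
  rw [himg, hausdorffMeasure_real, h0, mul_zero] at hle
  exact le_antisymm hle zero_le

/-- On the preimage of a null set, the derivative of a real function vanishes almost everywhere
where it exists. -/
lemma ae_deriv_eq_zero_of_mem_null {ψ : ℝ → ℝ} {N : Set ℝ} (hN : volume N = 0) :
    ∀ᵐ t, ψ t ∈ N → DifferentiableAt ℝ ψ t → deriv ψ t = 0 := by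
  set A : ℕ → Set ℝ := fun n => {t | ψ t ∈ N ∧
    ∀ s, |s - t| < 1 / ((n : ℝ) + 1) → |s - t| ≤ (n : ℝ≥0) * |ψ s - ψ t|} with hAdef
  have hA : ∀ n, volume (A n) = 0 := fun n =>
    volume_eq_zero_of_locally_expanding hN (n : ℝ≥0) (by positivity)
      (fun t ht => ht.1) (fun t ht => ht.2)
  rw [ae_iff]
  refine measure_mono_null ?_ (measure_iUnion_null hA)
  intro t ht
  simp only [Set.mem_ofPred_eq, Classical.not_imp] at ht
  obtain ⟨htN, hd, hne⟩ := ht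
  have hO := ((hasDerivAt_iff_isLittleO.1 hd.hasDerivAt))
  have hev : ∀ᶠ s in 𝓝 t, |s - t| ≤ 2 / |deriv ψ t| * |ψ s - ψ t| := by
    have hpos : 0 < |deriv ψ t| := abs_pos.2 hne
    filter_upwards [hO.def (half_pos hpos)] with s hs
    rw [Real.norm_eq_abs, Real.norm_eq_abs, smul_eq_mul] at hs
    have h1 : |(s - t) * deriv ψ t| ≤ |ψ s - ψ t| + |ψ s - ψ t - (s - t) * deriv ψ t| := by
      have := abs_sub (ψ s - ψ t) (ψ s - ψ t - (s - t) * deriv ψ t)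
      simpa using this
    rw [abs_mul] at h1
    rw [div_mul_eq_mul_div, le_div_iff₀ hpos]
    linarith
  obtain ⟨δ, hδ, hball⟩ := Metric.eventually_nhds_iff.1 hev
  obtain ⟨n, hn⟩ := exists_nat_gt (max (1 / δ) (2 / |deriv ψ t|))
  refine Set.mem_iUnion.2 ⟨n, htN, fun s hs => ?_⟩
  have hδn : 1 / ((n : ℝ) + 1) ≤ δ := by
    have h1 : 1 / δ ≤ (n : ℝ) + 1 := by linarith [le_max_left (1 / δ) (2 / |deriv ψ t|)]
    exact (one_div_le hδ (by positivity)).1 h1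
  refine (hball (by rw [Real.dist_eq]; linarith)).trans ?_
  refine mul_le_mul_of_nonneg_right ?_ (abs_nonneg _)
  rw [NNReal.coe_natCast]
  linarith [le_max_right (1 / δ) (2 / |deriv ψ t|)]

/-- On the preimage of a Lebesgue null set, a Lipschitz function on a finite-dimensional space is
differentiable with vanishing derivative at almost every point. This replaces the coarea formula;
it follows from Rademacher's theorem and the one-dimensional case on lines. -/
lemma LipschitzWith.ae_hasFDerivAt_zero_of_mem_null {H : Type*} [NormedAddCommGroup H]
    [NormedSpace ℝ H] [FiniteDimensional ℝ H] [MeasurableSpace H] [BorelSpace H]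
    (μ : Measure H) [μ.IsAddHaarMeasure] {g : H → ℝ} {C : ℝ≥0} (hg : LipschitzWith C g)
    {N : Set ℝ} (hNm : MeasurableSet N) (hN : volume N = 0) :
    ∀ᵐ h ∂μ, g h ∈ N → HasFDerivAt g (0 : H →L[ℝ] ℝ) h := by
  have hdir : ∀ v : H, ∀ᵐ h ∂μ, g h ∈ N → DifferentiableAt ℝ g h → fderiv ℝ g h v = 0 := by
    intro v
    set s : Set H := {h | g h ∈ N → DifferentiableAt ℝ g h → fderiv ℝ g h v = 0} with hs
    have hsm : MeasurableSet s := by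
      have h1 : MeasurableSet (g ⁻¹' N) := hg.continuous.measurable hNm
      have h2 := measurableSet_of_differentiableAt ℝ g
      have h3 : MeasurableSet {h | fderiv ℝ g h v = 0} :=
        measurable_fderiv_apply_const ℝ g v (measurableSet_singleton 0)
      have : s = (g ⁻¹' N)ᶜ ∪ ({h | DifferentiableAt ℝ g h}ᶜ ∪ {h | fderiv ℝ g h v = 0}) := by
        ext h
        simp only [hs, Set.mem_ofPred_eq, Set.mem_union, Set.mem_compl_iff, Set.mem_preimage]
        tauto
      rw [this]
      exact h1.compl.union (h2.compl.union h3)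
    refine ae_mem_of_ae_add_linearMap_mem
      ((1 : ℝ →L[ℝ] ℝ).smulRight v).toLinearMap volume μ hsm fun y => ?_
    filter_upwards [ae_deriv_eq_zero_of_mem_null (ψ := fun t => g (y + t • v)) hN] with t ht
    intro hmem hdiff
    have hline : HasDerivAt (fun t : ℝ => y + t • v) v t := by
      simpa using ((hasDerivAt_id t).smul_const v).const_add y
    have hcomp : HasDerivAt (fun t : ℝ => g (y + t • v)) (fderiv ℝ g (y + t • v) v) t :=
      (hdiff.hasFDerivAt (x := y + t • v)).comp_hasDerivAt t hline
    have := ht hmem hcomp.differentiableAt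
    rw [hcomp.deriv] at this
    simpa using this
  set b := Module.finBasis ℝ H
  have hall : ∀ᵐ h ∂μ, ∀ i, g h ∈ N → DifferentiableAt ℝ g h → fderiv ℝ g h (b i) = 0 :=
    ae_all_iff.2 fun i => hdir (b i)
  filter_upwards [hall, hg.ae_differentiableAt (μ := μ)] with h h1 h2 hmem
  have hz : fderiv ℝ g h = 0 := by
    ext w
    have : (fderiv ℝ g h).toLinearMap = 0 := b.ext fun i => by simpa using h1 i hmem h2
    simpa using congrArg (fun L : H →ₗ[ℝ] ℝ => L w) this
  rw [← hz]
  exact h2.hasFDerivAt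

/-! ### Projections of the surface measure -/

/-- A Lipschitz image of a Lebesgue null set is a null set for Hausdorff measure. -/
lemma LipschitzWith.euclideanHausdorffMeasure_image_eq_zero {X Y : Type*} [EMetricSpace X]
    [EMetricSpace Y] [MeasurableSpace X] [BorelSpace X] [MeasurableSpace Y] [BorelSpace Y]
    {K : ℝ≥0} {f : X → Y} (hf : LipschitzWith K f) {m : ℕ} {A : Set X}
    (hA : (μHE[m] : Measure X) A = 0) : (μHE[m] : Measure Y) (f '' A) = 0 := by
  have hc := Measure.addHaarScalarFactor_volume_hausdorffMeasure_ne_zero m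
  rw [Measure.euclideanHausdorffMeasure_def, Measure.smul_apply, ENNReal.smul_def, smul_eq_mul,
    mul_eq_zero] at hA ⊢
  have hA' := hA.resolve_left (by exact_mod_cast hc)
  right
  have := hf.hausdorffMeasure_image_le (d := m) (Nat.cast_nonneg m) A
  rw [hA', mul_zero] at this
  exact le_antisymm this zero_le

/-- Where the height function `⟪a, ·⟫` is critical along the graph parametrizing `S` near `x`,
the direction of `a` is normal to `S`. Here `π` is the projection to the parameter space. -/
lemma isUnitNormalAt_of_hasFDerivAt_zero {d : ℕ} {S : Set (EuclideanSpace ℝ (Fin d))}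
    {H : Type*} [NormedAddCommGroup H] [NormedSpace ℝ H]
    (π : EuclideanSpace ℝ (Fin d) →L[ℝ] H) (γ : H → EuclideanSpace ℝ (Fin d))
    {a x : EuclideanSpace ℝ (Fin d)} (ha : a ≠ 0) (hS : ∀ᶠ y in 𝓝[S] x, γ (π y) = y)
    (hx : γ (π x) = x) (hd : HasFDerivAt (fun h => inner ℝ a (γ h)) (0 : H →L[ℝ] ℝ) (π x)) :
    IsUnitNormalAt S x (‖a‖⁻¹ • a) := by
  refine ⟨by rw [norm_smul, norm_inv, norm_norm, inv_mul_cancel₀ (norm_ne_zero_iff.2 ha)], ?_⟩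
  have h1 := hd.isLittleO
  have ht : Tendsto π (𝓝[S] x) (𝓝 (π x)) := π.continuous.continuousAt.mono_left nhdsWithin_le_nhds
  have h2 : (fun y => inner ℝ a (γ (π y)) - inner ℝ a (γ (π x))) =o[𝓝[S] x]
      (fun y => π y - π x) := by
    simpa [Function.comp_def] using h1.comp_tendsto ht
  have h3 : (fun y => π y - π x) =O[𝓝[S] x] (fun y => y - x) := by
    simpa using π.isBigO_sub (𝓝[S] x) x
  have h4 : (fun y => inner ℝ a (y - x)) =o[𝓝[S] x] (fun y => y - x) := by
    refine (h2.trans_isBigO h3).congr' ?_ EventuallyEq.rfl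
    filter_upwards [hS] with y hy
    rw [hy, hx, inner_sub_right]
  simpa [inner_smul_left] using h4.const_mul_left (‖a‖⁻¹)

/-- If a nonresonant surface `S` is cut by the hyperplanes perpendicular to a nonzero integer
vector, then the hyperplanes whose heights lie in a null set meet `S` in a null set. -/
lemma surfaceMeasure_map_inner_absolutelyContinuous {d : ℕ} (hd : 2 ≤ d)
    {S : Set (EuclideanSpace ℝ (Fin d))} (hS : IsClosedLipschitzSurface S) (hres : NonResonant S)
    {k : Fin d → ℤ} (hk : k ≠ 0) :
    (surfaceMeasure S).map (fun x => inner ℝ (WithLp.toLp 2 fun i => (k i : ℝ)) x) ≪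
      (volume : Measure ℝ) := by
  set a : EuclideanSpace ℝ (Fin d) := WithLp.toLp 2 fun i => (k i : ℝ) with ha
  have ha0 : a ≠ 0 := by
    intro h
    refine hk (funext fun i => ?_)
    have : (k i : ℝ) = 0 := congrArg (fun v : EuclideanSpace ℝ (Fin d) => v i) h
    exact_mod_cast this
  have hrat : IsRationalVector (‖a‖⁻¹ • a) := ⟨‖a‖⁻¹, k, fun i => by simp [ha]⟩
  have hmeas : Measurable (fun x : EuclideanSpace ℝ (Fin d) => inner ℝ a x) := by fun_prop
  refine Measure.AbsolutelyContinuous.mk fun N hNm hN => ?_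
  rw [Measure.map_apply hmeas hNm, surfaceMeasure, Measure.restrict_apply (hmeas hNm)]
  set Z := {x | x ∈ S ∧ ∃ n, IsUnitNormalAt S x n ∧ IsRationalVector n} with hZ
  have hZ0 : (μHE[d - 1] : Measure (EuclideanSpace ℝ (Fin d))) Z = 0 := by
    rw [← Measure.restrict_eq_self _ (fun x (hx : x ∈ Z) => hx.1)]
    exact hres
  refine measure_null_of_locally_null _ fun p hp => ?_
  obtain ⟨e, r, K, φ, he, hr, hφ, hgr⟩ := hS.2 p hp.2
  refine ⟨((fun x => inner ℝ a x) ⁻¹' N ∩ S) ∩ Metric.ball p r,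
    inter_mem_nhdsWithin _ (Metric.ball_mem_nhds _ hr), ?_⟩
  set π := (ℝ ∙ e)ᗮ.orthogonalProjectionOnto with hπ
  set γ : (ℝ ∙ e)ᗮ → EuclideanSpace ℝ (Fin d) := fun h => φ h • e + h with hγ
  have hγlip : LipschitzWith (K + 1) γ := by
    refine LipschitzWith.of_dist_le_mul fun h h' => ?_
    have h1 := hφ.dist_le_mul h h'
    have h2 : dist (φ h • e) (φ h' • e) = dist (φ h) (φ h') := by
      rw [dist_eq_norm, ← sub_smul, norm_smul, he, mul_one, dist_eq_norm]
    calc dist (γ h) (γ h') ≤ dist (φ h • e) (φ h' • e) + dist (h : EuclideanSpace ℝ (Fin d)) h' :=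
          dist_add_add_le _ _ _ _
      _ ≤ K * dist h h' + dist h h' := by rw [h2]; exact add_le_add h1 le_rfl
      _ = _ := by push_cast; ring
  have hγπ : ∀ x ∈ Metric.ball p r, x ∈ S → γ (π x) = x := by
    intro x hx hxS
    have h1 := (hgr x hx).1 hxS
    have h2 := (ℝ ∙ e).starProjection_add_starProjection_orthogonal x
    rw [Submodule.starProjection_unit_singleton ℝ he, h1] at h2
    exact h2
  have hrank : Module.finrank ℝ (ℝ ∙ e)ᗮ = d - 1 := by
    have : Fact (Module.finrank ℝ (EuclideanSpace ℝ (Fin d)) = d - 1 + 1) :=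
      ⟨by rw [finrank_euclideanSpace_fin]; omega⟩
    exact Submodule.finrank_orthogonal_span_singleton (by rintro rfl; simp at he)
  have hglip : LipschitzWith (‖innerSL ℝ a‖₊ * (K + 1)) (fun h => inner ℝ a (γ h)) := by
    simpa [Function.comp_def] using (innerSL ℝ a).lipschitz.comp hγlip
  have hae := hglip.ae_hasFDerivAt_zero_of_mem_null
    (μHE[Module.finrank ℝ (ℝ ∙ e)ᗮ]) hNm hN
  rw [hrank, ae_iff] at hae
  have hbad := hγlip.euclideanHausdorffMeasure_image_eq_zero hae
  refine measure_mono_null ?_ (measure_union_null hbad hZ0)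
  rintro x ⟨⟨hxN, hxS⟩, hxp⟩
  by_cases hder : HasFDerivAt (fun h => inner ℝ a (γ h)) (0 : (ℝ ∙ e)ᗮ →L[ℝ] ℝ) (π x)
  · right
    refine ⟨hxS, _, isUnitNormalAt_of_hasFDerivAt_zero π γ ha0 ?_ (hγπ x hxp hxS) hder, hrat⟩
    filter_upwards [self_mem_nhdsWithin,
      mem_nhdsWithin_of_mem_nhds (Metric.isOpen_ball.mem_nhds hxp)] with y hy hyp
    exact hγπ y hyp hy
  · left
    refine ⟨π x, ?_, hγπ x hxp hxS⟩
    simp only [Set.mem_ofPred_eq, Classical.not_imp]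
    exact ⟨by rw [hγπ x hxp hxS]; exact hxN, hder⟩

/-! ### Equidistribution of dilated measures on the torus -/

lemma continuous_toTorus {d : ℕ} : Continuous (toTorus (d := d)) := by
  refine continuous_pi fun i => ?_
  exact (AddCircle.continuous_mk' 1).comp (by fun_prop)

instance isProbabilityMeasure_volume_unitAddTorus {d : ℕ} :
    IsProbabilityMeasure (volume : Measure (UnitAddTorus (Fin d))) := by
  have : IsProbabilityMeasure (volume : Measure UnitAddCircle) := ⟨UnitAddCircle.measure_univ⟩
  infer_instance

lemma integral_mFourier_eq_zero {d : ℕ} {k : Fin d → ℤ} (hk : k ≠ 0) :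
    ∫ y, UnitAddTorus.mFourier k y = 0 := by
  obtain ⟨i, hi⟩ := Function.ne_iff.1 hk
  have h := integral_fintype_prod_volume_eq_prod (𝕜 := ℂ)
    (fun (i : Fin d) (y : UnitAddCircle) => fourier (k i) y)
  refine h.trans (Finset.prod_eq_zero (Finset.mem_univ i) ?_)
  exact integral_eq_zero_of_add_right_eq_neg (fourier_add_half_inv_index hi one_pos)

/-- The character of frequency `k` on the torus, pulled back by a dilation of `ℝᵈ`, is a plane
wave that depends on `⟪k, x⟫` only. -/
lemma mFourier_toTorus_smul {d : ℕ} (k : Fin d → ℤ) (l : ℝ) (x : EuclideanSpace ℝ (Fin d)) :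
    UnitAddTorus.mFourier k (toTorus (l • x)) =
      Real.fourierChar (-(inner ℝ (WithLp.toLp 2 fun i => (k i : ℝ)) x * -l)) := by
  have h1 : UnitAddTorus.mFourier k (toTorus (l • x)) =
      ∏ i, Complex.exp (2 * Real.pi * Complex.I * k i * (l * x i : ℝ)) := by
    change ∏ i, fourier (k i) (toTorus (l • x) i) = _
    refine Finset.prod_congr rfl fun i _ => ?_
    have := fourier_coe_apply (T := 1) (n := k i) (x := l * x i)
    rw [Complex.ofReal_one, div_one] at this
    exact this
  rw [h1, ← Complex.exp_sum, Real.fourierChar_apply, PiLp.inner_apply]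
  congr 1
  push_cast [Finset.sum_mul, Finset.mul_sum, ← Finset.sum_neg_distrib]
  refine Finset.sum_congr rfl fun i _ => ?_
  simp
  ring

/-- The Riemann–Lebesgue lemma for finite absolutely continuous measures. -/
lemma tendsto_integral_fourierChar_of_absolutelyContinuous {ρ : Measure ℝ} [IsFiniteMeasure ρ]
    (hρ : ρ ≪ volume) :
    Tendsto (fun w : ℝ => ∫ v, (Real.fourierChar (-(v * w)) : ℂ) ∂ρ) (cocompact ℝ) (𝓝 0) := by
  have h := Real.tendsto_integral_exp_smul_cocompact
    (fun v => (((ρ.rnDeriv volume v).toReal : ℝ) : ℂ))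
  refine h.congr fun w => ?_
  rw [← integral_rnDeriv_smul hρ]
  refine integral_congr_ae (Eventually.of_forall fun v => ?_)
  simp [Circle.smul_def, mul_comm]

/-- If every projection of a finite measure `ν` along a nonzero integer vector is absolutely
continuous, then the dilates of `ν` become equidistributed on the torus. By density of the
trigonometric polynomials only the characters have to be considered. -/
lemma tendsto_integral_toTorus_smul {d : ℕ} {ν : Measure (EuclideanSpace ℝ (Fin d))}
    [IsFiniteMeasure ν]
    (hν : ∀ k : Fin d → ℤ, k ≠ 0 →
      ν.map (fun x => inner ℝ (WithLp.toLp 2 fun i => (k i : ℝ)) x) ≪ (volume : Measure ℝ))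
    (c : C(UnitAddTorus (Fin d), ℂ)) :
    Tendsto (fun l : ℝ => ∫ x, c (toTorus (l • x)) ∂ν) atTop
      (𝓝 (∫ _, (∫ y, c y) ∂ν)) := by
  have hint : ∀ (c : C(UnitAddTorus (Fin d), ℂ)) (l : ℝ),
      Integrable (fun x => c (toTorus (l • x))) ν := fun c l =>
    Integrable.of_bound
      (c.continuous.comp (continuous_toTorus.comp (continuous_const_smul l))).aestronglyMeasurable
      ‖c‖ (Eventually.of_forall fun x => c.norm_coe_le_norm _)
  have hintT : ∀ c : C(UnitAddTorus (Fin d), ℂ), Integrable (fun y => c y) volume := fun c =>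
    Integrable.of_bound c.continuous.aestronglyMeasurable
      ‖c‖ (Eventually.of_forall fun x => c.norm_coe_le_norm _)
  have hspan : ∀ c ∈ Submodule.span ℂ (Set.range (UnitAddTorus.mFourier (d := Fin d))),
      Tendsto (fun l : ℝ => ∫ x, c (toTorus (l • x)) ∂ν) atTop (𝓝 (∫ _, (∫ y, c y) ∂ν)) := by
    intro c hc
    induction hc using Submodule.span_induction with
    | mem c hc =>
      obtain ⟨k, rfl⟩ := hc
      by_cases hk : k = 0
      · subst hk
        simp [UnitAddTorus.mFourier_zero]
      · rw [integral_mFourier_eq_zero hk, integral_zero]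
        have hm : Measurable (fun x : EuclideanSpace ℝ (Fin d) =>
          inner ℝ (WithLp.toLp 2 fun i => (k i : ℝ)) x) := by fun_prop
        have h1 := (tendsto_integral_fourierChar_of_absolutelyContinuous (hν k hk)).comp
          ((tendsto_neg_atTop_atBot (G := ℝ)).mono_right atBot_le_cocompact)
        refine h1.congr fun l => ?_
        rw [Function.comp_apply, integral_map hm.aemeasurable (by fun_prop)]
        exact integral_congr_ae (Eventually.of_forall fun x => (mFourier_toTorus_smul k l x).symm)
    | zero => simp
    | add c c' _ _ h h' =>
      have := h.add h'
      rw [← integral_add (integrable_const _) (integrable_const _)] at this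
      simp only [ContinuousMap.add_apply]
      rw [integral_add (hintT c) (hintT c')]
      exact this.congr fun l => (integral_add (hint c l) (hint c' l)).symm
    | smul z c _ h =>
      simp only [ContinuousMap.smul_apply, integral_smul]
      exact h.const_smul z
  have hdense : c ∈ closure
      (Submodule.span ℂ (Set.range (UnitAddTorus.mFourier (d := Fin d))) :
        Set C(UnitAddTorus (Fin d), ℂ)) := by
    rw [← Submodule.topologicalClosure_coe, UnitAddTorus.span_mFourier_closure_eq_top]
    trivial
  rw [Metric.tendsto_atTop]
  intro ε hε
  set M := ν.real Set.univ with hM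
  have hM0 : 0 ≤ M := measureReal_nonneg
  set η := ε / (4 * (M + 1)) with hη
  have hη0 : 0 < η := by positivity
  obtain ⟨q, hq, hcq⟩ := Metric.mem_closure_iff.1 hdense η hη0
  obtain ⟨L, hL⟩ := Metric.tendsto_atTop.1 (hspan q hq) (ε / 4) (by positivity)
  refine ⟨L, fun l hl => ?_⟩
  rw [dist_eq_norm] at hcq
  have hpt : ∀ y, ‖c y - q y‖ ≤ η := fun y => ((c - q).norm_coe_le_norm y).trans hcq.le
  have hηM : η * M ≤ ε / 4 := by
    rw [hη, div_mul_eq_mul_div, div_le_div_iff₀ (by positivity) (by norm_num)]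
    nlinarith
  have e1 : ‖∫ x, c (toTorus (l • x)) ∂ν - ∫ x, q (toTorus (l • x)) ∂ν‖ ≤ ε / 4 := by
    rw [← integral_sub (hint c l) (hint q l)]
    exact (norm_integral_le_of_norm_le_const (Eventually.of_forall fun x => hpt _)).trans hηM
  have e2 : ‖∫ _, (∫ y, q y) ∂ν - ∫ _, (∫ y, c y) ∂ν‖ ≤ ε / 4 := by
    rw [← integral_sub (integrable_const _) (integrable_const _)]
    refine (norm_integral_le_of_norm_le_const (C := η) (Eventually.of_forall fun _ => ?_)).trans hηM
    rw [← integral_sub (hintT q) (hintT c)]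
    refine (norm_integral_le_of_norm_le_const (C := η)
      (Eventually.of_forall fun y => ?_)).trans (by simp)
    rw [norm_sub_rev]
    exact hpt y
  have e3 := hL l hl
  rw [dist_eq_norm] at e3 ⊢
  calc _ = ‖(∫ x, c (toTorus (l • x)) ∂ν - ∫ x, q (toTorus (l • x)) ∂ν)
        + (∫ x, q (toTorus (l • x)) ∂ν - ∫ _, (∫ y, q y) ∂ν)
        + (∫ _, (∫ y, q y) ∂ν - ∫ _, (∫ y, c y) ∂ν)‖ := by congr 1; abel
    _ ≤ _ := norm_add₃_le
    _ < ε := by linarith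

lemma tendsto_integral_toTorus_smul_real {d : ℕ} {ν : Measure (EuclideanSpace ℝ (Fin d))}
    [IsFiniteMeasure ν]
    (hν : ∀ k : Fin d → ℤ, k ≠ 0 →
      ν.map (fun x => inner ℝ (WithLp.toLp 2 fun i => (k i : ℝ)) x) ≪ (volume : Measure ℝ))
    (c : C(UnitAddTorus (Fin d), ℝ)) :
    Tendsto (fun l : ℝ => ∫ x, c (toTorus (l • x)) ∂ν) atTop (𝓝 (∫ _, (∫ y, c y) ∂ν)) := by
  have h := tendsto_integral_toTorus_smul hν
    ⟨fun y => (c y : ℂ), Complex.continuous_ofReal.comp c.continuous⟩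
  have h' := (Complex.continuous_re.tendsto _).comp h
  simp only [ContinuousMap.coe_mk, integral_complex_ofReal, Complex.ofReal_re,
    Function.comp_def] at h'
  exact h'

/-! ### Oscillating functionals on the Bochner space -/

/-- The error made on `F ∈ L¹(μ; C(𝕋ᵈ))` when the values on the dilated diagonal, `F(x, l x)`, are
replaced by the torus averages of `F(x, ·)`. -/
noncomputable def averagingError {d : ℕ} {μ : Measure (EuclideanSpace ℝ (Fin d))} (l : ℝ)
    (F : Lp C(UnitAddTorus (Fin d), ℝ) 1 μ) : ℝ :=
  (∫ x, F x (toTorus (l • x)) ∂μ) - ∫ x, (∫ y : UnitAddTorus (Fin d), F x y) ∂μ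

section averagingError

variable {d : ℕ} {μ : Measure (EuclideanSpace ℝ (Fin d))}

lemma integrable_apply_toTorus_smul (l : ℝ) (F : Lp C(UnitAddTorus (Fin d), ℝ) 1 μ) :
    Integrable (fun x => F x (toTorus (l • x))) μ := by
  refine (L1.integrable_coeFn F).norm.mono' ?_ (Eventually.of_forall fun x =>
    (F x).norm_coe_le_norm _)
  have hθ : AEStronglyMeasurable (fun x : EuclideanSpace ℝ (Fin d) => toTorus (l • x)) μ :=
    (continuous_toTorus.comp (continuous_const_smul l)).aestronglyMeasurable
  exact (continuous_eval (F := C(UnitAddTorus (Fin d), ℝ))).comp_aestronglyMeasurable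
    ((Lp.aestronglyMeasurable F).prodMk hθ)

lemma integrable_continuousMap_torus (c : C(UnitAddTorus (Fin d), ℝ)) :
    Integrable (fun y => c y) volume :=
  Integrable.of_bound c.continuous.aestronglyMeasurable
    ‖c‖ (Eventually.of_forall fun x => c.norm_coe_le_norm _)

lemma norm_integral_continuousMap_torus_le (c : C(UnitAddTorus (Fin d), ℝ)) :
    ‖∫ y, c y‖ ≤ ‖c‖ :=
  (norm_integral_le_of_norm_le_const (Eventually.of_forall fun y => c.norm_coe_le_norm y)).trans
    (by simp)

lemma continuous_integral_torus :
    Continuous (fun c : C(UnitAddTorus (Fin d), ℝ) => ∫ y, c y) := by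
  refine LipschitzWith.continuous (K := 1) (LipschitzWith.of_dist_le_mul fun c c' => ?_)
  rw [dist_eq_norm, dist_eq_norm, NNReal.coe_one, one_mul,
    ← integral_sub (integrable_continuousMap_torus c) (integrable_continuousMap_torus c')]
  exact norm_integral_continuousMap_torus_le (c - c')

lemma integrable_torus_average (F : Lp C(UnitAddTorus (Fin d), ℝ) 1 μ) :
    Integrable (fun x => ∫ y : UnitAddTorus (Fin d), F x y) μ :=
  (L1.integrable_coeFn F).norm.mono'
    (continuous_integral_torus.comp_aestronglyMeasurable (Lp.aestronglyMeasurable F))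
    (Eventually.of_forall fun x => norm_integral_continuousMap_torus_le (F x))

lemma averagingError_add (l : ℝ) (F G : Lp C(UnitAddTorus (Fin d), ℝ) 1 μ) :
    averagingError l (F + G) = averagingError l F + averagingError l G := by
  have h1 : ∫ x, (F + G : Lp C(UnitAddTorus (Fin d), ℝ) 1 μ) x (toTorus (l • x)) ∂μ =
      ∫ x, (F x (toTorus (l • x)) + G x (toTorus (l • x))) ∂μ := by
    refine integral_congr_ae ?_
    filter_upwards [Lp.coeFn_add F G] with x hx
    rw [hx]; rfl
  have h2 : ∫ x, (∫ y, (F + G : Lp C(UnitAddTorus (Fin d), ℝ) 1 μ) x y) ∂μ =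
      ∫ x, ((∫ y, F x y) + ∫ y, G x y) ∂μ := by
    refine integral_congr_ae ?_
    filter_upwards [Lp.coeFn_add F G] with x hx
    rw [hx]
    exact integral_add (integrable_continuousMap_torus _) (integrable_continuousMap_torus _)
  rw [averagingError, h1, h2,
    integral_add (integrable_apply_toTorus_smul l F) (integrable_apply_toTorus_smul l G),
    integral_add (integrable_torus_average F) (integrable_torus_average G), averagingError,
    averagingError]
  ring

lemma abs_averagingError_le (l : ℝ) (F : Lp C(UnitAddTorus (Fin d), ℝ) 1 μ) :
    |averagingError l F| ≤ 2 * ‖F‖ := by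
  have h1 : ‖∫ x, F x (toTorus (l • x)) ∂μ‖ ≤ ‖F‖ := by
    rw [L1.norm_eq_integral_norm]
    exact norm_integral_le_of_norm_le (L1.integrable_coeFn F).norm
      (Eventually.of_forall fun x => (F x).norm_coe_le_norm _)
  have h2 : ‖∫ x, (∫ y, F x y) ∂μ‖ ≤ ‖F‖ := by
    rw [L1.norm_eq_integral_norm]
    exact norm_integral_le_of_norm_le (L1.integrable_coeFn F).norm
      (Eventually.of_forall fun x => norm_integral_continuousMap_torus_le (F x))
  have := norm_sub_le (∫ x, F x (toTorus (l • x)) ∂μ) (∫ x, (∫ y, F x y) ∂μ)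
  rw [averagingError, ← Real.norm_eq_abs]
  linarith

lemma averagingError_smul (l t : ℝ) (F : Lp C(UnitAddTorus (Fin d), ℝ) 1 μ) :
    averagingError l (t • F) = t * averagingError l F := by
  have h1 : ∫ x, (t • F : Lp C(UnitAddTorus (Fin d), ℝ) 1 μ) x (toTorus (l • x)) ∂μ =
      ∫ x, t * F x (toTorus (l • x)) ∂μ := by
    refine integral_congr_ae ?_
    filter_upwards [Lp.coeFn_smul t F] with x hx
    rw [hx]; rfl
  have h2 : ∫ x, (∫ y, (t • F : Lp C(UnitAddTorus (Fin d), ℝ) 1 μ) x y) ∂μ =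
      ∫ x, t * (∫ y, F x y) ∂μ := by
    refine integral_congr_ae ?_
    filter_upwards [Lp.coeFn_smul t F] with x hx
    rw [hx, ← integral_const_mul]
    rfl
  rw [averagingError, h1, h2, integral_const_mul, integral_const_mul, averagingError, mul_sub]

/-- For a fixed element of the Bochner space the averaging error tends to `0`: for functions
`1_A(x) c(y)` this is equidistribution of the dilates of the restriction of `μ` to `A`, and these
span a dense subspace. -/
lemma tendsto_averagingError
    (hμ : ∀ k : Fin d → ℤ, k ≠ 0 →
      μ.map (fun x => inner ℝ (WithLp.toLp 2 fun i => (k i : ℝ)) x) ≪ (volume : Measure ℝ))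
    (F : Lp C(UnitAddTorus (Fin d), ℝ) 1 μ) :
    Tendsto (fun l => averagingError l F) atTop (𝓝 0) := by
  induction F using Lp.induction ENNReal.one_ne_top with
  | indicatorConst c hs hμs =>
    rename_i s
    have : IsFiniteMeasure (μ.restrict s) := ⟨by simpa using hμs⟩
    have h := tendsto_integral_toTorus_smul_real (ν := μ.restrict s) (fun k hk =>
      (Measure.absolutelyContinuous_of_le
        (Measure.map_mono Measure.restrict_le_self (by fun_prop))).trans (hμ k hk)) c
    refine (tendsto_sub_nhds_zero_iff.2 h).congr fun l => ?_
    have hcoe := indicatorConstLp_coeFn (p := 1) (hs := hs) (hμs := hμs.ne) (c := c)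
    rw [averagingError, Lp.simpleFunc.coe_indicatorConst]
    congr 1
    · rw [← integral_indicator hs]
      refine integral_congr_ae ?_
      filter_upwards [hcoe] with x hx
      rw [hx]
      by_cases hxs : x ∈ s <;> simp [hxs]
    · rw [← integral_indicator hs]
      refine integral_congr_ae ?_
      filter_upwards [hcoe] with x hx
      rw [hx]
      by_cases hxs : x ∈ s <;> simp [hxs]
  | add hf hg _ h1 h2 => simpa only [averagingError_add, add_zero] using h1.add h2
  | isClosed =>
    rw [← closure_subset_iff_isClosed]
    intro F hF
    rw [Set.mem_ofPred_eq, Metric.tendsto_atTop]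
    intro ε hε
    obtain ⟨G, hG, hFG⟩ := Metric.mem_closure_iff.1 hF (ε / 4) (by positivity)
    obtain ⟨L, hL⟩ := Metric.tendsto_atTop.1 hG (ε / 2) (by positivity)
    refine ⟨L, fun l hl => ?_⟩
    have h1 := hL l hl
    have h2 := abs_averagingError_le l (F - G)
    have h3 := averagingError_add l (F - G) G
    rw [sub_add_cancel] at h3
    rw [dist_zero_right, Real.norm_eq_abs] at h1 ⊢
    rw [dist_eq_norm] at hFG
    rw [h3]
    exact (abs_add_le _ _).trans_lt (by linarith)

/-- On a totally bounded set the averaging error tends to `0` uniformly. -/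
lemma eventually_averagingError_le_of_totallyBounded
    (hμ : ∀ k : Fin d → ℤ, k ≠ 0 →
      μ.map (fun x => inner ℝ (WithLp.toLp 2 fun i => (k i : ℝ)) x) ≪ (volume : Measure ℝ))
    {B : Set (Lp C(UnitAddTorus (Fin d), ℝ) 1 μ)} (hB : TotallyBounded B) {ε : ℝ} (hε : 0 < ε) :
    ∀ᶠ l in atTop, ∀ F ∈ B, |averagingError l F| ≤ ε := by
  obtain ⟨t, ht, hcov⟩ := Metric.totallyBounded_iff.1 hB (ε / 4) (by positivity)
  have hev : ∀ᶠ l in atTop, ∀ G ∈ t, |averagingError l G| < ε / 2 :=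
    (ht.eventually_all).2 fun G _ => by
      simpa using (tendsto_averagingError hμ G).abs.eventually_lt_const
        (by simpa using half_pos hε)
  filter_upwards [hev] with l hl F hF
  obtain ⟨G, hG, hFG⟩ := Set.mem_iUnion₂.1 (hcov hF)
  rw [Metric.mem_ball, dist_eq_norm] at hFG
  have h2 := abs_averagingError_le l (F - G)
  have h3 := averagingError_add l (F - G) G
  rw [sub_add_cancel] at h3
  rw [h3]
  exact (abs_add_le _ _).trans (by linarith [hl G hG])

end averagingError

theorem theorem2p4 (d : ℕ) (hd : 2 ≤ d) (S : Set (EuclideanSpace ℝ (Fin d)))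
    (hS : IsClosedLipschitzSurface S) (hres : NonResonant S)
    (X : Type*) [NormedAddCommGroup X] [NormedSpace ℝ X] [CompleteSpace X]
    (ι : X →L[ℝ] L1SurfaceTorus S) (hinj : Function.Injective ι) (hcpt : IsCompactOperator ι) :
    ∃ ω : ℝ → ℝ, Antitone ω ∧ Tendsto ω atTop (𝓝 0) ∧
      ∀ l : ℝ, 0 < l → ∀ f : X,
        |(∫ x, ι f x (toTorus (l • x)) ∂(surfaceMeasure S)) -
            ∫ x, (∫ y : UnitAddTorus (Fin d), ι f x y) ∂(surfaceMeasure S)| ≤ ω l * ‖f‖ := by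
  have hμ := fun (k : Fin d → ℤ) (hk : k ≠ 0) =>
    surfaceMeasure_map_inner_absolutelyContinuous hd hS hres hk
  set B : Set (L1SurfaceTorus S) := ι '' Metric.closedBall 0 1 with hBdef
  have hB : TotallyBounded B :=
    (IsCompactOperator.isCompact_closure_image_closedBall (f := ι.toLinearMap) hcpt 1
      ).totallyBounded.subset subset_closure
  -- The supremum of `E l` is the worst error on the unit ball at any dilation `≥ l`. For `l ≤ 0`
  -- it also covers dilations that are not positive, where the bound `2 * ‖ι‖` still holds.
  set E : ℝ → Set ℝ := fun l => {r | ∃ l' ≥ l, ∃ F ∈ B, r = |averagingError l' F|} with hE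
  have h0B : (0 : L1SurfaceTorus S) ∈ B := ⟨0, by simp, map_zero ι⟩
  have hne : ∀ l, (E l).Nonempty := fun l => ⟨_, l, le_rfl, 0, h0B, rfl⟩
  have hbdd : ∀ l, BddAbove (E l) := by
    intro l
    refine ⟨2 * ‖ι‖, ?_⟩
    rintro r ⟨l', -, F, ⟨f, hf, rfl⟩, rfl⟩
    have hf1 : ‖f‖ ≤ 1 := by simpa using hf
    have := ι.le_opNorm_of_le hf1
    linarith [abs_averagingError_le l' (ι f)]
  have hnonneg : ∀ l, 0 ≤ sSup (E l) := fun l => by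
    refine Real.sSup_nonneg ?_
    rintro r ⟨l', -, F, -, rfl⟩
    exact abs_nonneg _
  refine ⟨fun l => sSup (E l), ?_, ?_, ?_⟩
  · intro l₁ l₂ h12
    refine csSup_le_csSup (hbdd l₁) (hne l₂) ?_
    rintro r ⟨l', hl', F, hF, rfl⟩
    exact ⟨l', h12.trans hl', F, hF, rfl⟩
  · rw [Metric.tendsto_atTop]
    intro ε hε
    obtain ⟨L, hL⟩ := eventually_atTop.1
      (eventually_averagingError_le_of_totallyBounded hμ hB (half_pos hε))
    refine ⟨L, fun l hl => ?_⟩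
    have : sSup (E l) ≤ ε / 2 := by
      refine csSup_le (hne l) ?_
      rintro r ⟨l', hl', F, hF, rfl⟩
      exact hL l' (hl.trans hl') F hF
    rw [dist_zero_right, Real.norm_of_nonneg (hnonneg l)]
    linarith
  · intro l _ f
    change |averagingError l (ι f)| ≤ sSup (E l) * ‖f‖
    rcases eq_or_ne f 0 with rfl | hf
    · have := abs_averagingError_le l (ι 0)
      simpa using this
    have hf0 : 0 < ‖f‖ := norm_pos_iff.2 hf
    have hmem : ι (‖f‖⁻¹ • f) ∈ B :=
      ⟨_, by simp [norm_smul, inv_mul_cancel₀ hf0.ne'], rfl⟩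
    have h1 : |averagingError l (ι (‖f‖⁻¹ • f))| ≤ sSup (E l) :=
      le_csSup (hbdd l) ⟨l, le_rfl, _, hmem, rfl⟩
    rw [map_smul, averagingError_smul, abs_mul, abs_inv, abs_norm, inv_mul_le_iff₀ hf0] at h1
    rwa [mul_comm] at h1
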